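/- Let $k$ be a field with $\operatorname{char} k\neq 2$, let $a\in k^\times$, and let $K=k(\sqrt a)$ be a separable quadratic extension of $k$. Let $n$ be a non-negative integer, let $b_1,\dots,b_n\in k^\times$, and let $\sigma$ be the $k$-automorphism of the rational function field $K(x_1,\dots,x_n)$ given by $$\sigma:\ \sqrt a\mapsto -\sqrt a,\qquad x_i\mapsto \frac{b_i}{x_i}\quad(1\le i\le n).$$ Then the fixed field is $K(x_1,\dots,x_n)^{\langle\sigma\rangle}=k(s_i,t_i : 1\le i\le n)$ for some elements $s_i,t_i$ with defining relations $$s_i^2-a\,t_i^2=b_i\qquad(1\le i\le n),\tag{$*$}$$ that is, the ideal of all polynomial relations over $k$ among the $s_i,t_i$ is generated by the polynomials $S_i^2-aT_i^2-b_i$. Moreover, the following statements are equivalent: (i) $K(x_1,\dots,x_n)^{\langle\sigma\rangle}$ is $k$-rational; (ii) $K(x_1,\dots,x_n)^{\langle\sigma\rangle}$ is stably $k$-rational; (iii) $K(x_1,\dots,x_n)^{\langle\sigma\rangle}$ is $k$-unirational; (iv) the affine variety over $k$ defined by the equations $(*)$ has a $k$-rational point, i.e. there are $\alpha_i,\beta_i\in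 k$ with $\alpha_i^2-a\beta_i^2=b_i$ for all $i$; (v) $(a,b_i)_{2,k}=0$ for all $1\le i\le n$. Here a finitely generated extension field $L$ of $k$ is called $k$-rational if it is $k$-isomorphic to the quotient field of a polynomial ring $k[z_1,\dots,z_m]$ for some $m\ge 0$; stably $k$-rational if the rational function field $L(y_1,\dots,y_m)$ is $k$-rational for some $m\ge 0$; and $k$-unirational if it is $k$-isomorphic to a subfield of some $k$-rational field. The norm residue symbol $(a,b)_{2,k}$ of degree $2$ is the class in the Brauer group $\operatorname{Br}(k)$ (written additively) of the quaternion algebra over $k$ generated by $u,v$ with $u^2=a$, $v^2=b$, $uv=-vu$. -/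

import Mathlib

open Quaternion

section Rationality

universe u v

/-- `L / k` is `k`-rational: it is `k`-isomorphic to the quotient field of a polynomial ring
in finitely many variables over `k`. -/
def IsRationalField (k : Type u) (L : Type v) [Field k] [Field L] [Algebra k L] : Prop :=
  ∃ m : ℕ, Nonempty (L ≃ₐ[k] FractionRing (MvPolynomial (Fin m) k))

/-- `L / k` is stably `k`-rational: some rational function field `L(y₁, …, y_m)` is
`k`-rational. -/
def IsStablyRationalField (k : Type u) (L : Type v) [Field k] [Field L] [Algebra k L] : Prop :=
  ∃ m : ℕ, IsRationalField k (FractionRing (MvPolynomial (Fin m) L))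

/-- `L / k` is `k`-unirational: it is `k`-isomorphic to a subfield of some `k`-rational
field. -/
def IsUnirationalField (k : Type u) (L : Type v) [Field k] [Field L] [Algebra k L] : Prop :=
  ∃ m : ℕ, Nonempty (L →ₐ[k] FractionRing (MvPolynomial (Fin m) k))

end Rationality

section NormResidueSymbol

universe u

/-- The quaternion algebra with `i² = a`, `j² = b`, `ij = -ji`, for units `a`, `b`, is central
when the characteristic is not two. -/
theorem quaternion_isCentral {k : Type u} [Field k] [NeZero (2 : k)] (a b : kˣ) :
    Algebra.IsCentral k ℍ[k, (a : k), (b : k)] := by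
  have h2 : (2 : k) ≠ 0 := NeZero.ne 2
  refine ⟨fun q hq => ?_⟩
  rw [Subalgebra.mem_center_iff] at hq
  have hi := hq ⟨0, 1, 0, 0⟩
  have hj := hq ⟨0, 0, 1, 0⟩
  rw [QuaternionAlgebra.ext_iff] at hi hj
  simp at hi hj
  have ha := a.ne_zero
  have hb := b.ne_zero
  have hz : q.imJ = 0 := by
    have : (2 : k) * q.imJ = 0 := by linear_combination hi.2
    exact (mul_eq_zero.mp this).resolve_left h2
  have hy : q.imI = 0 := by
    have : (2 : k) * q.imI = 0 := by linear_combination -hj.2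
    exact (mul_eq_zero.mp this).resolve_left h2
  have hw : q.imK = 0 := by
    have : (a : k) * ((2 : k) * q.imK) = 0 := by linear_combination hi.1
    exact (mul_eq_zero.mp ((mul_eq_zero.mp this).resolve_left ha)).resolve_left h2
  refine Algebra.mem_bot.mpr ⟨q.re, ?_⟩
  ext <;> simp [hz, hy, hw]

/-- The same quaternion algebra is a simple ring. -/
theorem quaternion_isSimpleRing {k : Type u} [Field k] [NeZero (2 : k)] (a b : kˣ) :
    IsSimpleRing ℍ[k, (a : k), (b : k)] := by
  have h2 : (2 : k) ≠ 0 := NeZero.ne 2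
  have ha := a.ne_zero
  have hb := b.ne_zero
  have key : ∀ I : TwoSidedIdeal ℍ[k, (a : k), (b : k)], ∀ q ∈ I, q.re ≠ 0 → I = ⊤ := by
    intro I q hq hre
    rw [← TwoSidedIdeal.one_mem_iff]
    let c : ℍ[k, (a : k), (b : k)] := ⟨(4 * q.re)⁻¹, 0, 0, 0⟩
    have e : (1 : ℍ[k, (a : k), (b : k)]) =
        c * (q + (⟨0, (a : k)⁻¹, 0, 0⟩ : ℍ[k, (a : k), (b : k)]) * q * ⟨0, 1, 0, 0⟩
          + (⟨0, 0, (b : k)⁻¹, 0⟩ : ℍ[k, (a : k), (b : k)]) * q * ⟨0, 0, 1, 0⟩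
          + (⟨0, 0, 0, -((a : k) * b)⁻¹⟩ : ℍ[k, (a : k), (b : k)]) * q * ⟨0, 0, 0, 1⟩) := by
      have h4 : (4 : k) ≠ 0 := by
        have : (4 : k) = 2 * 2 := by norm_num
        rw [this]; exact mul_ne_zero h2 h2
      ext
      · simp [c]
        field_simp
        ring
      · simp only [c, QuaternionAlgebra.imI_mul, QuaternionAlgebra.imI_add,
          QuaternionAlgebra.re_mul, QuaternionAlgebra.re_add, QuaternionAlgebra.imI_one,
          QuaternionAlgebra.imJ_mul, QuaternionAlgebra.imK_mul]
        field_simp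
        ring
      · simp [c]
      · simp only [c, QuaternionAlgebra.imI_mul, QuaternionAlgebra.imK_add,
          QuaternionAlgebra.re_mul, QuaternionAlgebra.re_add, QuaternionAlgebra.imK_one,
          QuaternionAlgebra.imJ_mul, QuaternionAlgebra.imK_mul]
        field_simp
        ring
    rw [e]
    refine I.mul_mem_left _ _ (I.add_mem (I.add_mem (I.add_mem hq ?_) ?_) ?_) <;>
      exact I.mul_mem_right _ _ (I.mul_mem_left _ _ hq)
  refine ⟨⟨fun I => ?_⟩⟩
  by_cases h : I = ⊥
  · exact Or.inl h
  · refine Or.inr ?_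
    obtain ⟨q, hq, hq0⟩ : ∃ q ∈ I, q ≠ 0 := by
      by_contra! hc
      refine h (le_bot_iff.mp fun x hx => ?_)
      rw [TwoSidedIdeal.mem_bot]
      exact hc x hx
    by_cases h0 : q.re = 0
    · by_cases h1 : q.imI = 0
      · by_cases h3 : q.imJ = 0
        · refine key I _ (I.mul_mem_left ⟨0, 0, 0, 1⟩ q hq) ?_
          have h4 : q.imK ≠ 0 := fun h4 => hq0 (by ext <;> simp [h0, h1, h3, h4])
          simp [h4, h0, h1, h3]
        · refine key I _ (I.mul_mem_left ⟨0, 0, 1, 0⟩ q hq) ?_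
          simp [h3]
      · refine key I _ (I.mul_mem_left ⟨0, 1, 0, 0⟩ q hq) ?_
        simp [h1]
    · exact key I q hq h0

/-- The quaternion algebra `⟨u, v | u² = a, v² = b, uv = -vu⟩` as a central simple
`k`-algebra. -/
noncomputable def quaternionCSA {k : Type u} [Field k] [NeZero (2 : k)] (a b : kˣ) :
    CSA.{u, u} k where
  toAlgCat := AlgCat.of k ℍ[k, (a : k), (b : k)]
  isCentral := quaternion_isCentral a b
  isSimple := quaternion_isSimpleRing a b
  fin_dim := inferInstanceAs (Module.Finite k ℍ[k, (a : k), (b : k)])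

/-- The norm residue symbol `(a, b)_{2,k}`: the Brauer class of the quaternion algebra. -/
noncomputable def normResidueSymbol {k : Type u} [Field k] [NeZero (2 : k)] (a b : kˣ) :
    BrauerGroup.{u, u} k :=
  Quotient.mk (Brauer.CSA_Setoid k) (quaternionCSA a b)

/-- The field `k` as a central simple algebra over itself. -/
noncomputable def baseCSA (k : Type u) [Field k] : CSA.{u, u} k where
  toAlgCat := AlgCat.of k k
  isCentral := inferInstanceAs (Algebra.IsCentral k k)
  isSimple := inferInstanceAs (IsSimpleRing k)
  fin_dim := inferInstanceAs (Module.Finite k k)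

/-- The neutral element `0` of the (additively written) Brauer group: the class of `k`. -/
noncomputable def brauerZero (k : Type u) [Field k] : BrauerGroup.{u, u} k :=
  Quotient.mk (Brauer.CSA_Setoid k) (baseCSA k)

end NormResidueSymbol

/-!
Write `L = K(x₁, …, xₙ)`. With respect to `1, √a` the variable `xᵢ` has the coordinates
`sᵢ = (xᵢ + bᵢ/xᵢ)/2` and `tᵢ = (xᵢ - bᵢ/xᵢ)/(2√a)`, which `σ` fixes and which satisfy
`sᵢ² - a tᵢ² = xᵢ · (bᵢ/xᵢ) = bᵢ`. Put `F = k(s, t)`. Then `L = F(√a) = F ⊕ F √a`, and `σ` acts as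
`-1` on the second summand, so `F` is the fixed field
(`fixedField_zpowers_eq_of_adjoin_sqrt_eq_top`). There are no further relations because adjoining
`√a` to `k[S, T]/(Sᵢ² - a Tᵢ² - bᵢ)` gives a localization of `K[x₁, …, xₙ]`
(`ker_aeval_eq_span_norm_relations`).

For the equivalences, rational implies stably rational implies unirational formally. If `F` embeds
into `k(z₁, …, z_m)`, each form `x² - a y² - bᵢ z²` is isotropic over `k[z₁, …, z_m]`; taking top
coefficients one variable at a time makes it isotropic over `k`, and since `a` is not a square the
zero has `z ≠ 0`, so `bᵢ` is a norm (`exists_sq_sub_mul_sq_of_fractionRing`). This argument treats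
finite and infinite `k` alike. Conversely, if `bᵢ` is the norm of `cᵢ ∈ K`, the Möbius transforms
`uᵢ = √a (cᵢ + xᵢ)/(cᵢ - xᵢ)` are fixed by `σ` and generate `L` over `K`, so that the fixed field is
purely transcendental on the `uᵢ` (`isRationalField_fixedField`).

Finally, `b` is a norm from `k(√a)` exactly when the quaternion algebra `(a, b)` is trivial in the
Brauer group: a norm gives an explicit isomorphism with `M₂(k)`, and if `b` is not a norm then
`(a, b)` is a division algebra of dimension four, none of whose matrix algebras is isomorphic to a
matrix algebra over `k` (`exists_norm_of_normResidueSymbol_eq_brauerZero`).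
-/

/-! ### Quadratic extensions and involutions -/

theorem exists_eq_add_mul_of_adjoin_simple_eq_top {F L : Type*} [Field F] [Field L] [Algebra F L]
    {a : F} {β : L} (hβ : β ^ 2 = algebraMap F L a) (h : IntermediateField.adjoin F {β} = ⊤)
    (x : L) : ∃ r s : F, x = algebraMap F L r + algebraMap F L s * β := by
  have halg : IsAlgebraic F β := by
    refine IsIntegral.isAlgebraic ⟨Polynomial.X ^ 2 - Polynomial.C a,
      Polynomial.monic_X_pow_sub_C a two_ne_zero, ?_⟩
    simp [hβ]
  have hx : x ∈ Algebra.adjoin F {β} := by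
    rw [← IntermediateField.adjoin_simple_toSubalgebra_of_isAlgebraic halg,
      IntermediateField.mem_toSubalgebra, h]
    exact IntermediateField.mem_top
  induction hx using Algebra.adjoin_induction with
  | mem y hy => exact ⟨0, 1, by simp [Set.mem_singleton_iff.mp hy]⟩
  | algebraMap r => exact ⟨r, 0, by simp⟩
  | add y z _ _ hy hz =>
    obtain ⟨r, s, rfl⟩ := hy
    obtain ⟨r', s', rfl⟩ := hz
    exact ⟨r + r', s + s', by simp only [map_add]; ring⟩
  | mul y z _ _ hy hz =>
    obtain ⟨r, s, rfl⟩ := hy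
    obtain ⟨r', s', rfl⟩ := hz
    refine ⟨r * r' + a * (s * s'), r * s' + s * r', ?_⟩
    simp only [map_add, map_mul]
    linear_combination algebraMap F L s * algebraMap F L s' * hβ

theorem not_isSquare_of_adjoin_sqrt_eq_top {k K : Type*} [Field k] [Field K] [Algebra k K]
    [Algebra.IsQuadraticExtension k K] {a : k} {α : K} (hα : α ^ 2 = algebraMap k K a)
    (hK : IntermediateField.adjoin k {α} = ⊤) : ¬ IsSquare a := by
  rintro ⟨c, rfl⟩
  have hmem : α ∈ (⊥ : IntermediateField k K) := by
    have : α ^ 2 = algebraMap k K c ^ 2 := by rw [hα, map_mul, sq]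
    rw [IntermediateField.mem_bot]
    rcases sq_eq_sq_iff_eq_or_eq_neg.mp this with h | h
    · exact ⟨c, h.symm⟩
    · exact ⟨-c, by rw [h, map_neg]⟩
  rw [IntermediateField.adjoin_simple_eq_bot_iff.mpr hmem] at hK
  have h2 := Algebra.IsQuadraticExtension.finrank_eq_two k K
  rw [← IntermediateField.finrank_top', ← hK, IntermediateField.finrank_bot] at h2
  omega

/-- Over a field in which `a` is not a square, the norm form `x² - a y²` is anisotropic. -/
theorem eq_zero_of_sq_sub_mul_sq_eq_zero {k : Type*} [Field k] {a x y : k} (ha : ¬ IsSquare a)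
    (h : x ^ 2 - a * y ^ 2 = 0) : x = 0 ∧ y = 0 := by
  have hy : y = 0 := by
    by_contra hy
    refine ha ⟨x / y, ?_⟩
    field_simp
    linear_combination -h
  subst hy
  exact ⟨by simpa using h, rfl⟩

/-- An intermediate field `F` fixed pointwise by `σ` is the whole fixed field as soon as
`L = F(β)` for some `β` with `β² ∈ F` and `σ β = -β`: such an `L` is `F ⊕ F β`, and `σ` negates
the second summand. -/
theorem fixedField_zpowers_eq_of_adjoin_sqrt_eq_top {k L : Type*} [Field k] [Field L] [Algebra k L]
    (h2 : (2 : L) ≠ 0) (σ : L ≃ₐ[k] L) (F : IntermediateField k L) (hF : ∀ x ∈ F, σ x = x)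
    {a : F} {β : L} (hβ : β ^ 2 = a) (hβ0 : β ≠ 0) (hσβ : σ β = -β)
    (htop : IntermediateField.adjoin F {β} = ⊤) :
    IntermediateField.fixedField (Subgroup.zpowers σ) = F := by
  ext x
  rw [IntermediateField.mem_fixedField_iff]
  constructor
  · intro hx
    have hx := hx σ (Subgroup.mem_zpowers σ)
    obtain ⟨r, s, rfl⟩ := exists_eq_add_mul_of_adjoin_simple_eq_top hβ htop x
    change σ ((r : L) + s * β) = r + s * β at hx
    rw [map_add, map_mul, hF r r.2, hF s s.2, hσβ] at hx
    have : (2 : L) * (s * β) = 0 := by linear_combination -hx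
    have hs : (s : L) = 0 := by simpa [h2, hβ0] using this
    change (r : L) + s * β ∈ F
    rw [hs, zero_mul, add_zero]
    exact r.2
  · intro hx f hf
    obtain ⟨m, rfl⟩ := hf
    have : σ ∈ MulAction.stabilizer (L ≃ₐ[k] L) x := hF x hx
    exact (Subgroup.zpow_mem _ this m : σ ^ m ∈ MulAction.stabilizer (L ≃ₐ[k] L) x)

/-! ### Rational function fields -/

theorem subfield_eq_top_of_algebraMap_mem_of_X_mem {ι K : Type*} [Field K]
    (E : Subfield (FractionRing (MvPolynomial ι K)))
    (hC : ∀ c : K, algebraMap K (FractionRing (MvPolynomial ι K)) c ∈ E)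
    (hX : ∀ i, algebraMap (MvPolynomial ι K) (FractionRing (MvPolynomial ι K))
      (MvPolynomial.X i) ∈ E) : E = ⊤ := by
  have hp (p : MvPolynomial ι K) : algebraMap _ (FractionRing (MvPolynomial ι K)) p ∈ E := by
    induction p using MvPolynomial.induction_on with
    | C c => exact hC c
    | add p q hp hq => rw [map_add]; exact add_mem hp hq
    | mul_X p i hp => rw [map_mul]; exact mul_mem hp (hX i)
  refine eq_top_iff.mpr fun x _ => ?_
  obtain ⟨p, q, -, rfl⟩ := IsFractionRing.div_surjective (A := MvPolynomial ι K) x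
  exact div_mem (hp p) (hp q)

/-- If `K = k(α)`, then adjoining `α` to an intermediate field of `K(x₁, …, xₙ) / k` gives
everything once the result contains the variables. -/
theorem adjoin_simple_eq_top_of_X_mem {ι k K : Type*} [Field k] [Field K] [Algebra k K]
    {a : k} {α : K} (hα : α ^ 2 = algebraMap k K a) (hK : IntermediateField.adjoin k {α} = ⊤)
    (F : IntermediateField k (FractionRing (MvPolynomial ι K)))
    (hX : ∀ i, algebraMap (MvPolynomial ι K) (FractionRing (MvPolynomial ι K))
      (MvPolynomial.X i) ∈ IntermediateField.adjoin F
        {algebraMap K (FractionRing (MvPolynomial ι K)) α}) :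
    IntermediateField.adjoin F {algebraMap K (FractionRing (MvPolynomial ι K)) α} = ⊤ := by
  have key := subfield_eq_top_of_algebraMap_mem_of_X_mem (IntermediateField.adjoin F
    {algebraMap K (FractionRing (MvPolynomial ι K)) α}).toSubfield ?_ hX
  · refine eq_top_iff.mpr fun x _ => ?_
    exact key.ge (Subfield.mem_top x)
  · intro c
    have hk (r : k) : algebraMap K (FractionRing (MvPolynomial ι K)) (algebraMap k K r) ∈
        IntermediateField.adjoin F {algebraMap K (FractionRing (MvPolynomial ι K)) α} := by
      rw [← IsScalarTower.algebraMap_apply]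
      exact IntermediateField.algebraMap_mem _ (algebraMap k F r)
    obtain ⟨r, s, rfl⟩ := exists_eq_add_mul_of_adjoin_simple_eq_top hα hK c
    rw [map_add, map_mul]
    exact add_mem (hk r) (mul_mem (hk s) (IntermediateField.mem_adjoin_simple_self _ _))

/-- `n` elements generating `K(x₁, …, xₙ)` over `K` are algebraically independent, by comparing
transcendence degrees. -/
theorem algebraicIndependent_of_adjoin_range_eq_top {K : Type*} [Field K] {n : ℕ}
    (u : Fin n → FractionRing (MvPolynomial (Fin n) K))
    (hu : IntermediateField.adjoin K (Set.range u) = ⊤) : AlgebraicIndependent K u := by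
  have := IsLocalization.isAlgebraic (FractionRing (MvPolynomial (Fin n) K))
    (nonZeroDivisors (MvPolynomial (Fin n) K))
  have hX := (IsTranscendenceBasis.mvPolynomial (Fin n) K).algebraMap_comp
    (A := FractionRing (MvPolynomial (Fin n) K))
  have : Algebra.IsAlgebraic (Algebra.adjoin K (Set.range u))
      (FractionRing (MvPolynomial (Fin n) K)) := by
    refine ⟨fun x => ?_⟩
    have hx : x ∈ IntermediateField.adjoin K (Set.range u) := hu ▸ IntermediateField.mem_top
    obtain ⟨r, hr, s, hs, rfl⟩ := IntermediateField.mem_adjoin_iff_div.mp hx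
    rw [div_eq_mul_inv]
    exact (isAlgebraic_algebraMap (⟨r, hr⟩ : Algebra.adjoin K (Set.range u))).mul
      (isAlgebraic_algebraMap (⟨s, hs⟩ : Algebra.adjoin K (Set.range u))).inv
  exact (Algebra.IsAlgebraic.isTranscendenceBasis_of_lift_le_trdeg_of_finite K u
    hX.lift_cardinalMk_eq_trdeg.le).1

theorem IsRationalField.isStablyRationalField {k L : Type*} [Field k] [Field L] [Algebra k L]
    (h : IsRationalField k L) : IsStablyRationalField k L := by
  obtain ⟨m, ⟨e⟩⟩ := h
  refine ⟨0, m, ⟨AlgEquiv.trans ?_ e⟩⟩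
  have hb : Function.Bijective (algebraMap L (FractionRing (MvPolynomial (Fin 0) L))) := by
    refine ⟨(algebraMap L _).injective, fun x => ?_⟩
    obtain ⟨p, q, -, rfl⟩ := IsFractionRing.div_surjective (A := MvPolynomial (Fin 0) L) x
    obtain ⟨p, rfl⟩ := MvPolynomial.C_surjective (Fin 0) p
    obtain ⟨q, rfl⟩ := MvPolynomial.C_surjective (Fin 0) q
    exact ⟨p / q, map_div₀ _ _ _⟩
  exact (AlgEquiv.ofBijective
    (IsScalarTower.toAlgHom k L (FractionRing (MvPolynomial (Fin 0) L))) hb).symm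

theorem IsStablyRationalField.isUnirationalField {k L : Type*} [Field k] [Field L] [Algebra k L]
    (h : IsStablyRationalField k L) : IsUnirationalField k L := by
  obtain ⟨m, m', ⟨e⟩⟩ := h
  exact ⟨m', ⟨e.toAlgHom.comp (IsScalarTower.toAlgHom k L (FractionRing (MvPolynomial (Fin m) L)))⟩⟩

/-! ### Specialisation of rational points -/

/-- A nontrivial zero of `x² - a y² - b z²` over `R[X]` gives one over `R`: take the coefficients
in the highest degree that occurs. No hypothesis on the ring `R` is needed. -/
theorem exists_isotropic_of_polynomial {R : Type*} [CommRing R] {a b : R}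
    (h : ∃ f g z : Polynomial R, (f ≠ 0 ∨ g ≠ 0 ∨ z ≠ 0) ∧
      f ^ 2 - .C a * g ^ 2 = .C b * z ^ 2) :
    ∃ x y z : R, (x ≠ 0 ∨ y ≠ 0 ∨ z ≠ 0) ∧ x ^ 2 - a * y ^ 2 = b * z ^ 2 := by
  obtain ⟨f, g, z, hne, h⟩ := h
  set d := max f.natDegree (max g.natDegree z.natDegree) with hd
  have hf : f.natDegree ≤ d := by omega
  have hg : g.natDegree ≤ d := by omega
  have hz : z.natDegree ≤ d := by omega
  refine ⟨f.coeff d, g.coeff d, z.coeff d, ?_, ?_⟩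
  · by_contra! h0
    obtain ⟨h1, h2, h3⟩ := h0
    have aux (p : Polynomial R) (hp : p.coeff d = 0) (hpd : p.natDegree = d) (hp0 : p ≠ 0) :
        False := hp0 (Polynomial.leadingCoeff_eq_zero.mp (by rw [Polynomial.leadingCoeff, hpd, hp]))
    have aux0 (p : Polynomial R) (hp : p.coeff d = 0) (hd0 : d = 0) (hpd : p.natDegree ≤ d) :
        p = 0 := by
      by_contra hp0
      exact aux p hp (by omega) hp0
    by_cases hd0 : d = 0
    · have e1 := aux0 f h1 hd0 hf
      have e2 := aux0 g h2 hd0 hg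
      have e3 := aux0 z h3 hd0 hz
      simp [e1, e2, e3] at hne
    · have hpos (p : Polynomial R) (hpd : p.natDegree = d) : p ≠ 0 := by
        rintro rfl
        exact hd0 (by simpa using hpd.symm)
      rcases (by omega : f.natDegree = d ∨ g.natDegree = d ∨ z.natDegree = d) with e | e | e
      · exact aux f h1 e (hpos f e)
      · exact aux g h2 e (hpos g e)
      · exact aux z h3 e (hpos z e)
  · have h' := congrArg (fun p => p.coeff (2 * d)) h
    simpa only [Polynomial.coeff_sub, Polynomial.coeff_C_mul,
      Polynomial.coeff_pow_of_natDegree_le hf, Polynomial.coeff_pow_of_natDegree_le hg,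
      Polynomial.coeff_pow_of_natDegree_le hz] using h'

theorem exists_isotropic_of_mvPolynomial {R : Type*} [CommRing R] {a b : R} (m : ℕ)
    (h : ∃ f g z : MvPolynomial (Fin m) R, (f ≠ 0 ∨ g ≠ 0 ∨ z ≠ 0) ∧
      f ^ 2 - .C a * g ^ 2 = .C b * z ^ 2) :
    ∃ x y z : R, (x ≠ 0 ∨ y ≠ 0 ∨ z ≠ 0) ∧ x ^ 2 - a * y ^ 2 = b * z ^ 2 := by
  induction m with
  | zero =>
    obtain ⟨f, g, z, hne, h⟩ := h
    obtain ⟨f, rfl⟩ := MvPolynomial.C_surjective (Fin 0) f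
    obtain ⟨g, rfl⟩ := MvPolynomial.C_surjective (Fin 0) g
    obtain ⟨z, rfl⟩ := MvPolynomial.C_surjective (Fin 0) z
    refine ⟨f, g, z, by simpa using hne, MvPolynomial.C_injective (Fin 0) R ?_⟩
    simpa using h
  | succ m ih =>
    obtain ⟨f, g, z, hne, h⟩ := h
    let e := MvPolynomial.finSuccEquiv R m
    have hC (r : R) : e (.C r) = .C (.C r) := by
      simp [e, MvPolynomial.finSuccEquiv_apply]
    refine ih (exists_isotropic_of_polynomial ⟨e f, e g, e z, by simpa using hne, ?_⟩)
    rw [← hC, ← hC, ← map_pow, ← map_pow, ← map_pow, ← map_mul, ← map_mul, ← map_sub, h]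

/-- If `b` is a norm from `k(√a)` after passing to a purely transcendental extension of `k`, it
already is one over `k`. -/
theorem exists_sq_sub_mul_sq_of_fractionRing {k : Type*} [Field k] {a b : k} (ha : ¬ IsSquare a)
    {m : ℕ} {f g : FractionRing (MvPolynomial (Fin m) k)}
    (h : f ^ 2 - algebraMap k _ a * g ^ 2 = algebraMap k _ b) :
    ∃ x y : k, x ^ 2 - a * y ^ 2 = b := by
  have inj := IsFractionRing.injective (MvPolynomial (Fin m) k) (FractionRing (MvPolynomial (Fin m) k))
  have hC (r : k) : algebraMap k (FractionRing (MvPolynomial (Fin m) k)) r =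
      algebraMap (MvPolynomial (Fin m) k) (FractionRing (MvPolynomial (Fin m) k)) (.C r) := rfl
  obtain ⟨p, q, hq, rfl⟩ := IsFractionRing.div_surjective (A := MvPolynomial (Fin m) k) f
  obtain ⟨p', q', hq', rfl⟩ := IsFractionRing.div_surjective (A := MvPolynomial (Fin m) k) g
  have hq := nonZeroDivisors.ne_zero hq
  have hq' := nonZeroDivisors.ne_zero hq'
  have hq1 : algebraMap (MvPolynomial (Fin m) k) (FractionRing (MvPolynomial (Fin m) k)) q ≠ 0 := by
    simpa using hq
  have hq1' : algebraMap (MvPolynomial (Fin m) k) (FractionRing (MvPolynomial (Fin m) k)) q' ≠ 0 := by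
    simpa using hq'
  obtain ⟨x, y, w, hne, hxy⟩ := exists_isotropic_of_mvPolynomial m (a := a) (b := b)
    ⟨p * q', p' * q, q * q', Or.inr (Or.inr (mul_ne_zero hq hq')), by
      apply inj
      rw [hC, hC] at h
      field_simp at h
      simp only [map_sub, map_mul, map_pow]
      linear_combination h⟩
  by_cases hw : w = 0
  · subst hw
    obtain ⟨rfl, rfl⟩ := eq_zero_of_sq_sub_mul_sq_eq_zero ha (x := x) (y := y) (by simpa using hxy)
    simp at hne
  · refine ⟨x / w, y / w, ?_⟩
    field_simp
    linear_combination hxy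

/-! ### Splitting of quaternion algebras -/

/-- `i ↦ !![0, a; 1, 0]`, `j ↦ !![s, -a t; t, -s]`: a two-dimensional representation of the
quaternion algebra `(a, s² - a t²)`. -/
def splitQuaternionBasis {k : Type*} [Field k] {a b s t : k} (h : s ^ 2 - a * t ^ 2 = b) :
    QuaternionAlgebra.Basis (Matrix (Fin 2) (Fin 2) k) a 0 b where
  i := !![0, a; 1, 0]
  j := !![s, -a * t; t, -s]
  k := !![a * t, -a * s; s, -a * t]
  i_mul_i := by
    ext i j; fin_cases i <;> fin_cases j <;> simp [Matrix.mul_apply]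
  j_mul_j := by
    subst h
    ext i j; fin_cases i <;> fin_cases j <;> simp [Matrix.mul_apply] <;> ring
  i_mul_j := by
    ext i j; fin_cases i <;> fin_cases j <;> simp [Matrix.mul_apply]
  j_mul_i := by
    ext i j; fin_cases i <;> fin_cases j <;> simp [Matrix.mul_apply] <;> ring

theorem normResidueSymbol_eq_brauerZero_of_norm {k : Type*} [Field k] [NeZero (2 : k)] {a b : kˣ}
    {s t : k} (h : s ^ 2 - (a : k) * t ^ 2 = b) : normResidueSymbol a b = brauerZero k := by
  have := quaternion_isSimpleRing a b
  let φ : ℍ[k, (a : k), (b : k)] →ₐ[k] Matrix (Fin 2) (Fin 2) k := (splitQuaternionBasis h).liftHom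
  have hinj : Function.Injective φ := φ.toRingHom.injective
  have hdim : Module.finrank k ℍ[k, (a : k), (b : k)] =
      Module.finrank k (Matrix (Fin 2) (Fin 2) k) := by
    rw [QuaternionAlgebra.finrank_eq_four, Module.finrank_matrix]
    simp
  have hbij : Function.Bijective φ :=
    ⟨hinj, (LinearMap.injective_iff_surjective_of_finrank_eq_finrank (f := φ.toLinearMap) hdim).mp
      hinj⟩
  refine Quotient.sound ⟨1, 1 * 2, one_ne_zero, by norm_num, ⟨?_⟩⟩
  exact ((AlgEquiv.ofBijective φ hbij).mapMatrix (m := Fin 1)).trans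
    ((Matrix.compAlgEquiv (Fin 1) (Fin 2) k k).trans
      (Matrix.reindexAlgEquiv k k finProdFinEquiv))

/-- If the quaternion norm `N(q) = (x² - a y²) - b (z² - a w²)` has a nontrivial zero, then `b` is
a quotient of values of the anisotropic form `x² - a y²`, hence itself such a value. -/
theorem quaternion_norm_ne_zero {k : Type*} [Field k] {a b : k} (ha : ¬ IsSquare a)
    (hb : ¬ ∃ s t : k, s ^ 2 - a * t ^ 2 = b) {q : ℍ[k, a, b]} (hq : q ≠ 0) :
    (q.re ^ 2 - a * q.imI ^ 2) - b * (q.imJ ^ 2 - a * q.imK ^ 2) ≠ 0 := by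
  intro h
  by_cases h0 : q.imJ ^ 2 - a * q.imK ^ 2 = 0
  · obtain ⟨h3, h4⟩ := eq_zero_of_sq_sub_mul_sq_eq_zero ha h0
    obtain ⟨h1, h2⟩ := eq_zero_of_sq_sub_mul_sq_eq_zero ha (x := q.re) (y := q.imI)
      (by simpa [h0] using h)
    exact hq (by ext <;> simp [h1, h2, h3, h4])
  · -- The quotient of the norms of `re + imI √a` and `imJ + imK √a`.
    refine hb ⟨(q.re * q.imJ - a * q.imI * q.imK) / (q.imJ ^ 2 - a * q.imK ^ 2),
      (q.imI * q.imJ - q.re * q.imK) / (q.imJ ^ 2 - a * q.imK ^ 2), ?_⟩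
    field_simp
    linear_combination (q.imJ ^ 2 - a * q.imK ^ 2) * h

theorem quaternion_exists_left_inverse {k : Type*} [Field k] {a b : k} (ha : ¬ IsSquare a)
    (hb : ¬ ∃ s t : k, s ^ 2 - a * t ^ 2 = b) {q : ℍ[k, a, b]} (hq : q ≠ 0) :
    ∃ p : ℍ[k, a, b], p * q = 1 := by
  have hN := quaternion_norm_ne_zero ha hb hq
  refine ⟨((q.re ^ 2 - a * q.imI ^ 2) - b * (q.imJ ^ 2 - a * q.imK ^ 2))⁻¹ • star q, ?_⟩
  rw [smul_mul_assoc]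
  have : star q * q =
      ((q.re ^ 2 - a * q.imI ^ 2) - b * (q.imJ ^ 2 - a * q.imK ^ 2)) • (1 : ℍ[k, a, b]) := by
    ext <;> simp <;> ring
  rw [this, smul_smul, inv_mul_cancel₀ hN, one_smul]

/-- A matrix algebra over `k` has a nonzero "rank one" element in each corner `e M e`, that is, an
element `T` with `T X T ∈ k T` for all `X`. -/
theorem exists_rank_one_mem_corner {k : Type*} [Field k] {m : ℕ} {e : Matrix (Fin m) (Fin m) k}
    (he : e * e = e) (he0 : e ≠ 0) :
    ∃ T : Matrix (Fin m) (Fin m) k, T ≠ 0 ∧ e * T * e = T ∧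
      ∀ X, ∃ c : k, T * X * T = c • T := by
  obtain ⟨i, j, hij⟩ : ∃ i j, e i j ≠ 0 := by
    by_contra! h
    exact he0 (Matrix.ext h)
  -- The product of column `j` and row `i` of `e`.
  refine ⟨e * Matrix.single j i 1 * e, fun h => ?_, ?_, fun X => ⟨(e * X * e) i j, ?_⟩⟩
  · have := congrFun (congrFun h i) j
    rw [Matrix.mul_assoc, Matrix.mul_apply] at this
    simp [Matrix.single, Matrix.mul_apply, hij, ite_and] at this
  · simp only [← Matrix.mul_assoc, he]
    rw [Matrix.mul_assoc, he]
  · have key (Y : Matrix (Fin m) (Fin m) k) :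
        Matrix.single j i 1 * Y * Matrix.single j i 1 = Y i j • Matrix.single j i (1 : k) := by
      simp [Matrix.single_mul_mul_single]
    have := key (e * X * e)
    calc e * Matrix.single j i 1 * e * X * (e * Matrix.single j i 1 * e)
        = e * (Matrix.single j i 1 * (e * X * e) * Matrix.single j i 1) * e := by
          simp only [Matrix.mul_assoc]
      _ = _ := by rw [this, Matrix.mul_smul, Matrix.smul_mul]

/-- If `b` is not a norm, the quaternion algebra `ℍ` is a division algebra. An isomorphism
`Mₙ(ℍ) ≃ Mₘ(k)` then produces, from a rank one matrix in the corner of the matrix unit `E₁₁`, a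
nonzero `h ∈ ℍ` with `h q h ∈ k h` for all `q`. Cancelling `h` gives `h q ∈ k` for all `q`, hence
`ℍ = k`, which is absurd. -/
theorem exists_norm_of_normResidueSymbol_eq_brauerZero {k : Type*} [Field k] [NeZero (2 : k)]
    {a b : kˣ} (ha : ¬ IsSquare (a : k)) (h : normResidueSymbol a b = brauerZero k) :
    ∃ s t : k, s ^ 2 - (a : k) * t ^ 2 = b := by
  by_contra hb
  obtain ⟨n, m, hn, -, ⟨φ⟩⟩ := Quotient.exact h
  change Matrix (Fin n) (Fin n) ℍ[k, (a : k), (b : k)] ≃ₐ[k] Matrix (Fin m) (Fin m) k at φ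
  let i₀ : Fin n := ⟨0, Nat.pos_of_ne_zero hn⟩
  have hE : (Matrix.single i₀ i₀ (1 : ℍ[k, (a : k), (b : k)])) ≠ 0 := by
    intro h
    have := congrFun (congrFun h i₀) i₀
    simp at this
  obtain ⟨T, hT0, hTe, hT⟩ := exists_rank_one_mem_corner
    (e := φ (Matrix.single i₀ i₀ 1)) (by rw [← map_mul]; simp) (by simpa using hE)
  let h := φ.symm T i₀ i₀
  have hTh : φ.symm T = Matrix.single i₀ i₀ h := by
    have := congrArg φ.symm hTe
    rw [map_mul, map_mul, φ.symm_apply_apply] at this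
    rw [← this, Matrix.single_mul_mul_single, one_mul, mul_one]
  have hh0 : h ≠ 0 := by
    intro h0
    rw [h0, Matrix.single_zero] at hTh
    exact hT0 (by simpa using hTh)
  obtain ⟨p, hp⟩ := quaternion_exists_left_inverse ha hb hh0
  have hhq (q : ℍ[k, (a : k), (b : k)]) : ∃ c : k, q * h = c • 1 := by
    obtain ⟨c, hc⟩ := hT (φ (Matrix.single i₀ i₀ q))
    have := congrArg φ.symm hc
    rw [map_mul, map_mul, φ.symm_apply_apply, map_smul, hTh] at this
    have := congrFun (congrFun this i₀) i₀
    simp at this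
    refine ⟨c, ?_⟩
    calc q * h = p * h * q * h := by rw [hp, one_mul]
      _ = p * (h * q * h) := by simp only [mul_assoc]
      _ = c • 1 := by rw [this, mul_smul_comm, hp]
  obtain ⟨c, hc⟩ := hhq 1
  obtain ⟨d, hd⟩ := hhq ⟨0, 1, 0, 0⟩
  rw [one_mul] at hc
  have hc0 : c ≠ 0 := by
    rintro rfl
    exact hh0 (by simpa using hc)
  rw [hc, mul_smul_comm, mul_one] at hd
  have := congrArg QuaternionAlgebra.imI hd
  simp [hc0] at this

/-! ### The ideal of relations -/

/-- The map `K → R[√a]` induced by `√a ↦ √a`, for a `k`-algebra `R` and `K = k(√a)`. -/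
theorem exists_algHom_quadraticAlgebra {k K : Type*} [Field k] [Field K] [Algebra k K]
    {a : k} {α : K} (hα : α ^ 2 = algebraMap k K a) (hK : IntermediateField.adjoin k {α} = ⊤)
    (ha : ¬ IsSquare a) (R : Type*) [CommRing R] [Algebra k R] :
    ∃ f : K →ₐ[k] QuadraticAlgebra R (algebraMap k R a) 0, f α = ⟨0, 1⟩ := by
  let g : QuadraticAlgebra k a 0 →ₐ[k] K :=
    QuadraticAlgebra.lift ⟨α, by rw [zero_smul, add_zero, ← sq, hα, Algebra.algebraMap_eq_smul_one]⟩
  have hg (z : QuadraticAlgebra k a 0) :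
      g z = algebraMap k K z.re + algebraMap k K z.im * α := by
    simp [g, QuadraticAlgebra.lift, Algebra.smul_def]
  have hbij : Function.Bijective g := by
    constructor
    · rw [injective_iff_map_eq_zero]
      intro z hz
      rw [hg] at hz
      have : z.re ^ 2 - a * z.im ^ 2 = 0 := by
        apply (algebraMap k K).injective
        simp only [map_sub, map_pow, map_mul, map_zero, ← hα]
        linear_combination (algebraMap k K z.re - algebraMap k K z.im * α) * hz
      obtain ⟨h1, h2⟩ := eq_zero_of_sq_sub_mul_sq_eq_zero ha this
      ext <;> simp [h1, h2]
    · intro x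
      obtain ⟨r, s, rfl⟩ := exists_eq_add_mul_of_adjoin_simple_eq_top hα hK x
      exact ⟨⟨r, s⟩, hg _⟩
  let e := AlgEquiv.ofBijective g hbij
  have he : e.symm α = ⟨0, 1⟩ := by
    rw [AlgEquiv.symm_apply_eq]
    simp [e, hg]
  let f : QuadraticAlgebra k a 0 →ₐ[k] QuadraticAlgebra R (algebraMap k R a) 0 :=
    QuadraticAlgebra.lift ⟨⟨0, 1⟩, by
      ext <;> simp [Algebra.smul_def] <;> rfl⟩
  refine ⟨f.comp e.symm, ?_⟩
  rw [AlgHom.comp_apply]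
  change f (e.symm α) = _
  rw [he]
  simp [f, QuadraticAlgebra.lift]

/-- Let `A = k[S, T] / (Sᵢ² - a Tᵢ² - bᵢ)`. In `A[√a]` the elements `Sᵢ + √a Tᵢ` are units, with
inverse `bᵢ⁻¹ (Sᵢ - √a Tᵢ)`, so the substitution `xᵢ ↦ Sᵢ + √a Tᵢ` makes `A[√a]` a localization
of `K[x₁, …, xₙ]`: every element of `A` becomes, after multiplication by a unit, the image of a
polynomial in the `xᵢ`. A relation between the `sᵢ` and `tᵢ` corresponds to a polynomial vanishing
in `K(x₁, …, xₙ)`, that is, to zero. -/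
theorem ker_aeval_eq_span_norm_relations {k K : Type*} [Field k] [Field K] [Algebra k K]
    [NeZero (2 : k)] {a : kˣ} {α : K} (hα : α ^ 2 = algebraMap k K a)
    (hK : IntermediateField.adjoin k {α} = ⊤) (ha : ¬ IsSquare (a : k))
    {ι : Type*} (b : ι → kˣ) (s t : ι → FractionRing (MvPolynomial ι K))
    (hst : ∀ i, s i ^ 2 - algebraMap k _ (a : k) * t i ^ 2 = algebraMap k _ (b i : k))
    (hx : ∀ i, s i + algebraMap K _ α * t i = algebraMap (MvPolynomial ι K) _ (MvPolynomial.X i)) :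
    RingHom.ker (MvPolynomial.aeval (R := k) (Sum.elim s t)) =
      Ideal.span (Set.range fun i : ι =>
        (MvPolynomial.X (Sum.inl i) ^ 2
          - MvPolynomial.C (a : k) * MvPolynomial.X (Sum.inr i) ^ 2
          - MvPolynomial.C (b i : k) : MvPolynomial (ι ⊕ ι) k)) := by
  set I := Ideal.span (Set.range fun i : ι =>
        (MvPolynomial.X (Sum.inl i) ^ 2
          - MvPolynomial.C (a : k) * MvPolynomial.X (Sum.inr i) ^ 2
          - MvPolynomial.C (b i : k) : MvPolynomial (ι ⊕ ι) k)) with hI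
  let θ : MvPolynomial (ι ⊕ ι) k →ₐ[k] FractionRing (MvPolynomial ι K) :=
    MvPolynomial.aeval (R := k) (Sum.elim s t)
  change RingHom.ker θ = I
  refine le_antisymm (fun p hp => ?_) ?_
  swap
  · rw [hI, Ideal.span_le]
    rintro _ ⟨i, rfl⟩
    simp only [SetLike.mem_coe, RingHom.mem_ker, θ, map_sub, map_mul, map_pow,
      MvPolynomial.aeval_X, MvPolynomial.aeval_C, Sum.elim_inl, Sum.elim_inr]
    exact sub_eq_zero.mpr (hst i)
  let A := MvPolynomial (ι ⊕ ι) k ⧸ I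
  let B := QuadraticAlgebra A (algebraMap k A a) 0
  obtain ⟨f, hf⟩ := exists_algHom_quadraticAlgebra hα hK ha A
  let π : MvPolynomial (ι ⊕ ι) k →+* B := (algebraMap A B).comp (Ideal.Quotient.mk I)
  have hπC (c : k) : π (.C c) = algebraMap k B c := rfl
  have hπ (i : ι) : π (.X (.inl i)) ^ 2 - algebraMap k B a * π (.X (.inr i)) ^ 2 =
      algebraMap k B (b i) := by
    rw [← hπC, ← hπC, ← map_pow, ← map_pow, ← map_mul, ← map_sub, ← sub_eq_zero, ← map_sub]
    simp only [π, RingHom.comp_apply]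
    rw [Ideal.Quotient.eq_zero_iff_mem.mpr (Ideal.subset_span (Set.mem_range_self i)), map_zero]
  have hfα : f α ^ 2 = algebraMap k B a := by rw [← map_pow, hα, f.commutes]
  let ψ : MvPolynomial ι K →+* B :=
    MvPolynomial.eval₂Hom f.toRingHom fun i => π (.X (.inl i)) + f α * π (.X (.inr i))
  have hψC (c : K) : ψ (.C c) = f c := MvPolynomial.eval₂Hom_C _ _ _
  have hψX (i : ι) : ψ (.X i) = π (.X (.inl i)) + f α * π (.X (.inr i)) :=
    MvPolynomial.eval₂Hom_X' _ _ _
  have hunit (c : kˣ) : IsUnit (algebraMap k B c) := c.isUnit.map _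
  have h2u : IsUnit (2 : B) := by
    have := (IsUnit.mk0 (2 : k) (NeZero.ne 2)).map (algebraMap k B)
    rwa [map_ofNat] at this
  have hαu : IsUnit (f α) := isUnit_of_mul_isUnit_left (y := f α) (by
    rw [← sq, hfα]; exact hunit a)
  have hXu (i : ι) : IsUnit (ψ (.X i)) :=
    isUnit_of_mul_isUnit_left (y := π (.X (.inl i)) - f α * π (.X (.inr i))) (by
      have : ψ (.X i) * (π (.X (.inl i)) - f α * π (.X (.inr i))) = algebraMap k B (b i) := by
        rw [hψX]
        linear_combination hπ i - π (.X (.inr i)) ^ 2 * hfα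
      rw [this]
      exact hunit (b i))
  let ρ : MvPolynomial ι K →+* FractionRing (MvPolynomial ι K) := algebraMap _ _
  have hρC (c : K) : ρ (.C c) = algebraMap K _ c := rfl
  have hρα : (algebraMap K (FractionRing (MvPolynomial ι K)) α) ^ 2 = algebraMap k _ (a : k) := by
    rw [← map_pow, hα, ← IsScalarTower.algebraMap_apply]
  have hρk (c : k) : algebraMap K (FractionRing (MvPolynomial ι K)) (algebraMap k K c) =
      algebraMap k _ c := (IsScalarTower.algebraMap_apply _ _ _ _).symm
  -- `q / m` represents `p` in `B` and in `K(x)` at the same time.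
  have key (p : MvPolynomial (ι ⊕ ι) k) : ∃ m q : MvPolynomial ι K,
      IsUnit (ψ m) ∧ ψ m * π p = ψ q ∧ ρ m * θ p = ρ q := by
    induction p using MvPolynomial.induction_on with
    | C c =>
      refine ⟨1, .C (algebraMap k K c), by simp, ?_, ?_⟩
      · rw [map_one, one_mul, hψC, hπC, f.commutes]
      · rw [map_one, one_mul, hρC, hρk]
        exact θ.commutes c
    | add p p' hp hp' =>
      obtain ⟨m, q, hm, h1, h2⟩ := hp
      obtain ⟨m', q', hm', h1', h2'⟩ := hp'
      refine ⟨m * m', q * m' + q' * m, by rw [map_mul]; exact hm.mul hm', ?_, ?_⟩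
      · simp only [map_add, map_mul]
        linear_combination ψ m' * h1 + ψ m * h1'
      · simp only [map_add, map_mul]
        linear_combination ρ m' * h2 + ρ m * h2'
    | mul_X p j hp =>
      obtain ⟨m, q, hm, h1, h2⟩ := hp
      obtain ⟨m', q', hm', h1', h2'⟩ : ∃ m q : MvPolynomial ι K,
          IsUnit (ψ m) ∧ ψ m * π (.X j) = ψ q ∧ ρ m * θ (.X j) = ρ q := by
        rcases j with i | i
        · -- `2 xᵢ sᵢ = xᵢ² + bᵢ`
          refine ⟨2 * .X i, .X i ^ 2 + .C (algebraMap k K (b i)), ?_, ?_, ?_⟩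
          · rw [map_mul, map_ofNat]
            exact h2u.mul (hXu i)
          · simp only [map_mul, map_add, map_pow, map_ofNat, hψC, hψX, f.commutes]
            linear_combination hπ i - π (.X (.inr i)) ^ 2 * hfα
          · simp only [map_mul, map_add, map_pow, map_ofNat, hρC, hρk, θ, MvPolynomial.aeval_X,
              Sum.elim_inl]
            rw [← hx]
            linear_combination hst i - t i ^ 2 * hρα
        · -- `2 √a xᵢ tᵢ = xᵢ² - bᵢ`
          refine ⟨2 * .C α * .X i, .X i ^ 2 - .C (algebraMap k K (b i)), ?_, ?_, ?_⟩
          · rw [map_mul, map_mul, map_ofNat, hψC]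
            exact (h2u.mul hαu).mul (hXu i)
          · simp only [map_mul, map_sub, map_pow, map_ofNat, hψC, hψX, f.commutes]
            linear_combination -hπ i + π (.X (.inr i)) ^ 2 * hfα
          · simp only [map_mul, map_sub, map_pow, map_ofNat, hρC, hρk, θ, MvPolynomial.aeval_X,
              Sum.elim_inr]
            rw [← hx]
            linear_combination -hst i + t i ^ 2 * hρα
      refine ⟨m * m', q * q', by rw [map_mul]; exact hm.mul hm', ?_, ?_⟩
      · simp only [map_mul, ← h1, ← h1']
        ring
      · simp only [map_mul, ← h2, ← h2']
        ring
  obtain ⟨m, q, hm, h1, h2⟩ := key p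
  have hp0 : θ p = 0 := hp
  have hq : q = 0 := by
    apply IsFractionRing.injective (MvPolynomial ι K) (FractionRing (MvPolynomial ι K))
    rw [map_zero]
    exact h2.symm.trans (by rw [hp0, mul_zero])
  rw [hq, map_zero, hm.mul_right_eq_zero] at h1
  exact Ideal.Quotient.eq_zero_iff_mem.mp
    (QuadraticAlgebra.algebraMap_injective (h1.trans (map_zero _).symm))

/-! ### The fixed field of the involution -/

/-- An element `x` with `σ x = b / x` has coordinates `s = (x + b/x)/2`, `t = (x - b/x)/(2β)` with
respect to `1, β` that are fixed by `σ`. -/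
theorem exists_fixed_norm_coordinates {k L : Type*} [Field k] [Field L] [Algebra k L]
    (h2 : (2 : L) ≠ 0) (σ : L ≃ₐ[k] L) {b : k} {β x : L} (hβ0 : β ≠ 0) (hx0 : x ≠ 0)
    (hσβ : σ β = -β) (hσx : σ x = algebraMap k L b / x) :
    ∃ s t : L, σ s = s ∧ σ t = t ∧ s + β * t = x ∧ s ^ 2 - β ^ 2 * t ^ 2 = algebraMap k L b := by
  have hb0 : algebraMap k L b ≠ 0 := by
    intro h
    rw [h, zero_div] at hσx
    exact hx0 ((map_eq_zero σ).mp hσx)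
  refine ⟨(x + algebraMap k L b / x) / 2, (x - algebraMap k L b / x) / (2 * β), ?_, ?_, ?_, ?_⟩
  · simp only [map_div₀, map_add, hσx, AlgEquiv.commutes, map_ofNat]
    field_simp
    ring
  · simp only [map_div₀, map_sub, map_mul, hσx, hσβ, AlgEquiv.commutes, map_ofNat]
    field_simp
    ring
  · field_simp
    ring
  · field_simp
    ring

/-- If `σ x = b / x` and `b = c σ(c)`, then `w = x / c` satisfies `σ w = 1 / w`, so that
`u = β (1 + w) / (1 - w)` is fixed by `σ`; the inverse transformation is
`x = c (u - β) / (u + β)`. -/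
theorem exists_fixed_moebius {k L : Type*} [Field k] [Field L] [Algebra k L]
    (h2 : (2 : L) ≠ 0) (σ : L ≃ₐ[k] L) {b : k} {β x c : L} (hβ0 : β ≠ 0) (hx0 : x ≠ 0)
    (hσβ : σ β = -β) (hσx : σ x = algebraMap k L b / x) (hc : c * σ c = algebraMap k L b)
    (hcx : c ≠ x) : ∃ u : L, σ u = u ∧ x = c * (u - β) / (u + β) := by
  have hb0 : algebraMap k L b ≠ 0 := by
    intro h
    rw [h, zero_div] at hσx
    exact hx0 ((map_eq_zero σ).mp hσx)
  have hc0 : c ≠ 0 := left_ne_zero_of_mul (hc ▸ hb0)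
  have hcx' : c - x ≠ 0 := sub_ne_zero.mpr hcx
  refine ⟨β * (c + x) / (c - x), ?_, ?_⟩
  · have h3 : σ c - algebraMap k L b / x ≠ 0 := by
      rw [← hσx, ← map_sub]
      exact (map_ne_zero σ).mpr hcx'
    simp only [map_div₀, map_mul, map_add, map_sub, hσx, hσβ]
    rw [div_eq_div_iff h3 hcx', ← hc]
    field_simp
    ring
  · have : β * (c + x) / (c - x) + β = 2 * β * c / (c - x) := by
      field_simp
      ring
    rw [this]
    field_simp
    ring

theorem algebraMap_sqrt_sq {ι k K : Type*} [Field k] [Field K] [Algebra k K] {a : k} {α : K}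
    (hα : α ^ 2 = algebraMap k K a) :
    algebraMap K (FractionRing (MvPolynomial ι K)) α ^ 2 = algebraMap k _ a := by
  rw [← map_pow, hα, ← IsScalarTower.algebraMap_apply]

/-- If every variable `xᵢ` lies in `F(√a)` for `F` generated over `k` by elements fixed by `σ`,
then `F` is the fixed field. -/
theorem fixedField_eq_adjoin_of_X_mem {ι k K : Type*} [Field k] [NeZero (2 : k)] [Field K]
    [Algebra k K] {a : kˣ} {α : K} (hα : α ^ 2 = algebraMap k K a)
    (hK : IntermediateField.adjoin k {α} = ⊤)
    {σ : FractionRing (MvPolynomial ι K) ≃ₐ[k] FractionRing (MvPolynomial ι K)}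
    (hσα : σ (algebraMap K _ α) = -algebraMap K _ α) {S : Set (FractionRing (MvPolynomial ι K))}
    (hS : ∀ x ∈ S, σ x = x)
    (hX : ∀ i, algebraMap (MvPolynomial ι K) (FractionRing (MvPolynomial ι K))
      (MvPolynomial.X i) ∈ IntermediateField.adjoin (IntermediateField.adjoin k S)
        {algebraMap K (FractionRing (MvPolynomial ι K)) α}) :
    IntermediateField.fixedField (Subgroup.zpowers σ) = IntermediateField.adjoin k S := by
  have h2 : (2 : FractionRing (MvPolynomial ι K)) ≠ 0 := by
    rw [← map_ofNat (algebraMap k _) 2]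
    exact (map_ne_zero _).mpr (NeZero.ne 2)
  have hα0 : α ≠ 0 := by
    rintro rfl
    exact a.ne_zero (by simpa using hα.symm)
  refine fixedField_zpowers_eq_of_adjoin_sqrt_eq_top h2 σ _ (fun y hy => ?_)
    (a := algebraMap k _ a) (algebraMap_sqrt_sq hα) ((map_ne_zero _).mpr hα0) hσα
    (adjoin_simple_eq_top_of_X_mem hα hK _ hX)
  induction hy using IntermediateField.adjoin_induction with
  | mem y hy => exact hS y hy
  | algebraMap r => exact σ.commutes r
  | add y z _ _ hy hz => rw [map_add, hy, hz]
  | mul y z _ _ hy hz => rw [map_mul, hy, hz]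
  | inv y _ hy => rw [map_inv₀, hy]

theorem exists_norm_coordinates_fixedField {k K : Type*} [Field k] [NeZero (2 : k)] [Field K]
    [Algebra k K] {a : kˣ} {α : K} (hα : α ^ 2 = algebraMap k K a)
    (hK : IntermediateField.adjoin k {α} = ⊤) {ι : Type*} {b : ι → kˣ}
    {σ : FractionRing (MvPolynomial ι K) ≃ₐ[k] FractionRing (MvPolynomial ι K)}
    (hσα : σ (algebraMap K _ α) = -algebraMap K _ α)
    (hσx : ∀ i, σ (algebraMap (MvPolynomial ι K) _ (MvPolynomial.X i)) =
      algebraMap k _ (b i : k) / algebraMap (MvPolynomial ι K) _ (MvPolynomial.X i)) :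
    ∃ s t : ι → FractionRing (MvPolynomial ι K),
      IntermediateField.fixedField (Subgroup.zpowers σ) =
        IntermediateField.adjoin k (Set.range s ∪ Set.range t) ∧
      (∀ i, s i ^ 2 - algebraMap k _ (a : k) * t i ^ 2 = algebraMap k _ (b i : k)) ∧
      ∀ i, s i + algebraMap K _ α * t i =
        algebraMap (MvPolynomial ι K) _ (MvPolynomial.X i) := by
  have h2 : (2 : FractionRing (MvPolynomial ι K)) ≠ 0 := by
    rw [← map_ofNat (algebraMap k _) 2]
    exact (map_ne_zero _).mpr (NeZero.ne 2)
  have hα0 : α ≠ 0 := by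
    rintro rfl
    exact a.ne_zero (by simpa using hα.symm)
  choose s t hs ht hx hst using fun i => exists_fixed_norm_coordinates h2 σ
    ((map_ne_zero (algebraMap K (FractionRing (MvPolynomial ι K)))).mpr hα0)
    (by simp) hσα (hσx i)
  refine ⟨s, t, fixedField_eq_adjoin_of_X_mem hα hK hσα ?_ fun i => ?_,
    fun i => algebraMap_sqrt_sq (ι := ι) hα ▸ hst i, hx⟩
  · rintro _ (⟨i, rfl⟩ | ⟨i, rfl⟩)
    · exact hs i
    · exact ht i
  · let F := IntermediateField.adjoin k (Set.range s ∪ Set.range t)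
    have hsF : s i ∈ F := IntermediateField.subset_adjoin _ _ (Or.inl ⟨i, rfl⟩)
    have htF : t i ∈ F := IntermediateField.subset_adjoin _ _ (Or.inr ⟨i, rfl⟩)
    rw [← hx i]
    exact add_mem (IntermediateField.algebraMap_mem _ (⟨s i, hsF⟩ : F))
      (mul_mem (IntermediateField.mem_adjoin_simple_self _ _)
        (IntermediateField.algebraMap_mem _ (⟨t i, htF⟩ : F)))

/-- If each `bᵢ` is the norm of some `cᵢ = sᵢ + √a tᵢ ∈ K`, replace `xᵢ` by its Möbius transform
`uᵢ` fixed by `σ`. The `uᵢ` still generate `K(x₁, …, xₙ)` over `K`, hence are algebraically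
independent, and the fixed field is the rational function field `k(u₁, …, uₙ)`. -/
theorem isRationalField_fixedField {k K : Type*} [Field k] [NeZero (2 : k)] [Field K]
    [Algebra k K] {a : kˣ} {α : K} (hα : α ^ 2 = algebraMap k K a)
    (hK : IntermediateField.adjoin k {α} = ⊤) {n : ℕ} {b : Fin n → kˣ}
    {σ : FractionRing (MvPolynomial (Fin n) K) ≃ₐ[k] FractionRing (MvPolynomial (Fin n) K)}
    (hσα : σ (algebraMap K _ α) = -algebraMap K _ α)
    (hσx : ∀ i, σ (algebraMap (MvPolynomial (Fin n) K) _ (MvPolynomial.X i)) =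
      algebraMap k _ (b i : k) / algebraMap (MvPolynomial (Fin n) K) _ (MvPolynomial.X i))
    {s t : Fin n → k} (hst : ∀ i, s i ^ 2 - (a : k) * t i ^ 2 = (b i : k)) :
    IsRationalField k (IntermediateField.fixedField (Subgroup.zpowers σ)) := by
  have h2 : (2 : FractionRing (MvPolynomial (Fin n) K)) ≠ 0 := by
    rw [← map_ofNat (algebraMap k _) 2]
    exact (map_ne_zero _).mpr (NeZero.ne 2)
  have hα0 : α ≠ 0 := by
    rintro rfl
    exact a.ne_zero (by simpa using hα.symm)
  have hβ := algebraMap_sqrt_sq (ι := Fin n) hα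
  let cK : Fin n → K := fun i => algebraMap k K (s i) + algebraMap k K (t i) * α
  have hc (i : Fin n) : algebraMap K (FractionRing (MvPolynomial (Fin n) K)) (cK i) =
      algebraMap k _ (s i) + algebraMap k _ (t i) * algebraMap K _ α := by
    simp only [cK, map_add, map_mul, ← IsScalarTower.algebraMap_apply]
  have hcσ (i : Fin n) : algebraMap K (FractionRing (MvPolynomial (Fin n) K)) (cK i) *
      σ (algebraMap K _ (cK i)) = algebraMap k _ (b i : k) := by
    rw [hc, ← hst i]
    simp only [map_add, map_sub, map_mul, map_pow, AlgEquiv.commutes, hσα]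
    linear_combination -(algebraMap k (FractionRing (MvPolynomial (Fin n) K)) (t i)) ^ 2 * hβ
  have hcx (i : Fin n) : algebraMap K (FractionRing (MvPolynomial (Fin n) K)) (cK i) ≠
      algebraMap (MvPolynomial (Fin n) K) _ (MvPolynomial.X i) := by
    intro h
    have h : (MvPolynomial.C (cK i) : MvPolynomial (Fin n) K) = MvPolynomial.X i :=
      IsFractionRing.injective (MvPolynomial (Fin n) K) (FractionRing (MvPolynomial (Fin n) K)) h
    have := congrArg MvPolynomial.totalDegree h
    rw [MvPolynomial.totalDegree_C, MvPolynomial.totalDegree_X] at this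
    exact zero_ne_one this
  choose u hσu hxu using fun i => exists_fixed_moebius h2 σ
    ((map_ne_zero (algebraMap K (FractionRing (MvPolynomial (Fin n) K)))).mpr hα0)
    (by simp) hσα (hσx i) (hcσ i) (hcx i)
  have hKu : IntermediateField.adjoin K (Set.range u) = ⊤ := by
    have hmem (i : Fin n) : u i ∈ IntermediateField.adjoin K (Set.range u) :=
      IntermediateField.subset_adjoin _ _ ⟨i, rfl⟩
    have key := subfield_eq_top_of_algebraMap_mem_of_X_mem
      (IntermediateField.adjoin K (Set.range u)).toSubfield
      (fun y => IntermediateField.algebraMap_mem _ y) (fun i => ?_)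
    · exact eq_top_iff.mpr fun y _ => key.ge (Subfield.mem_top y)
    · have hβm := IntermediateField.algebraMap_mem (IntermediateField.adjoin K (Set.range u)) α
      rw [hxu i]
      exact div_mem (mul_mem (IntermediateField.algebraMap_mem _ _) (sub_mem (hmem i) hβm))
        (add_mem (hmem i) hβm)
  have hind : AlgebraicIndependent k u :=
    (algebraicIndependent_of_adjoin_range_eq_top u hKu).restrictScalars (algebraMap k K).injective
  have hfix : IntermediateField.fixedField (Subgroup.zpowers σ) =
      IntermediateField.adjoin k (Set.range u) := by
    refine fixedField_eq_adjoin_of_X_mem hα hK hσα ?_ fun i => ?_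
    · rintro _ ⟨i, rfl⟩
      exact hσu i
    · let F := IntermediateField.adjoin k (Set.range u)
      let β := algebraMap K (FractionRing (MvPolynomial (Fin n) K)) α
      have hk (r : k) : algebraMap k _ r ∈ IntermediateField.adjoin F {β} :=
        IntermediateField.algebraMap_mem _ (algebraMap k F r)
      have hβm : β ∈ IntermediateField.adjoin F {β} :=
        IntermediateField.mem_adjoin_simple_self _ _
      have hu : u i ∈ IntermediateField.adjoin F {β} :=
        IntermediateField.algebraMap_mem _
          (⟨u i, IntermediateField.subset_adjoin _ _ ⟨i, rfl⟩⟩ : F)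
      rw [hxu i, hc i]
      exact div_mem (mul_mem (add_mem (hk _) (mul_mem (hk _) hβm)) (sub_mem hu hβm))
        (add_mem hu hβm)
  exact ⟨n, ⟨(IntermediateField.equivOfEq hfix).trans hind.aevalEquivField.symm⟩⟩

theorem theorem2p11 {k K : Type*} [Field k] [NeZero (2 : k)] [Field K] [Algebra k K]
    [Algebra.IsQuadraticExtension k K]
    -- `K = k(√a)`, a quadratic extension; `α` is `√a`
    (a : kˣ) (α : K) (hα : α ^ 2 = algebraMap k K (a : k))
    (hK : IntermediateField.adjoin k {α} = ⊤)
    (n : ℕ) (b : Fin n → kˣ)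
    -- the automorphism `σ` of `K(x₁, …, xₙ)` over `k`
    (σ : FractionRing (MvPolynomial (Fin n) K) ≃ₐ[k] FractionRing (MvPolynomial (Fin n) K))
    (hσα : σ (algebraMap K _ α) = -algebraMap K _ α)
    (hσx : ∀ i : Fin n,
      σ (algebraMap (MvPolynomial (Fin n) K) _ (MvPolynomial.X i)) =
        algebraMap k _ (b i : k) / algebraMap (MvPolynomial (Fin n) K) _ (MvPolynomial.X i)) :
    -- the fixed field is `k(sᵢ, tᵢ)` with `sᵢ² - a tᵢ² = bᵢ` as defining relations
    (∃ s t : Fin n → FractionRing (MvPolynomial (Fin n) K),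
      IntermediateField.fixedField (Subgroup.zpowers σ) =
        IntermediateField.adjoin k (Set.range s ∪ Set.range t) ∧
      (∀ i, s i ^ 2 - algebraMap k _ (a : k) * t i ^ 2 = algebraMap k _ (b i : k)) ∧
      RingHom.ker (MvPolynomial.aeval (R := k) (Sum.elim s t)) =
        Ideal.span (Set.range fun i : Fin n =>
          (MvPolynomial.X (Sum.inl i) ^ 2
            - MvPolynomial.C (a : k) * MvPolynomial.X (Sum.inr i) ^ 2
            - MvPolynomial.C (b i : k) : MvPolynomial (Fin n ⊕ Fin n) k))) ∧
    List.TFAE [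
      IsRationalField k (IntermediateField.fixedField (Subgroup.zpowers σ)),
      IsStablyRationalField k (IntermediateField.fixedField (Subgroup.zpowers σ)),
      IsUnirationalField k (IntermediateField.fixedField (Subgroup.zpowers σ)),
      ∃ s t : Fin n → k, ∀ i, s i ^ 2 - (a : k) * t i ^ 2 = (b i : k),
      ∀ i, normResidueSymbol a (b i) = brauerZero k] := by
  have ha := not_isSquare_of_adjoin_sqrt_eq_top hα hK
  obtain ⟨s, t, hfix, hst, hx⟩ := exists_norm_coordinates_fixedField hα hK hσα hσx
  refine ⟨⟨s, t, hfix, hst, ker_aeval_eq_span_norm_relations hα hK ha b s t hst hx⟩, ?_⟩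
  tfae_have 1 → 2 := IsRationalField.isStablyRationalField
  tfae_have 2 → 3 := IsStablyRationalField.isUnirationalField
  tfae_have 3 → 4 := by
    rintro ⟨m, ⟨φ⟩⟩
    let F := IntermediateField.fixedField (Subgroup.zpowers σ)
    have hs (i : Fin n) : s i ∈ F :=
      hfix.ge (IntermediateField.subset_adjoin _ _ (Or.inl ⟨i, rfl⟩))
    have ht (i : Fin n) : t i ∈ F :=
      hfix.ge (IntermediateField.subset_adjoin _ _ (Or.inr ⟨i, rfl⟩))
    have hF (i : Fin n) : (⟨s i, hs i⟩ : F) ^ 2 - algebraMap k F a * ⟨t i, ht i⟩ ^ 2 =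
        algebraMap k F (b i) := Subtype.ext (hst i)
    have hpt (i : Fin n) : ∃ x y : k, x ^ 2 - (a : k) * y ^ 2 = b i := by
      refine exists_sq_sub_mul_sq_of_fractionRing ha (m := m) (f := φ ⟨s i, hs i⟩)
        (g := φ ⟨t i, ht i⟩) ?_
      have := congrArg φ (hF i)
      rwa [map_sub, map_mul, map_pow, map_pow, φ.commutes, φ.commutes] at this
    choose x y hxy using hpt
    exact ⟨x, y, hxy⟩
  tfae_have 4 → 1 := by
    rintro ⟨x, y, hxy⟩
    exact isRationalField_fixedField hα hK hσα hσx hxy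
  tfae_have 4 → 5 := by
    rintro ⟨x, y, hxy⟩ i
    exact normResidueSymbol_eq_brauerZero_of_norm (hxy i)
  tfae_have 5 → 4 := by
    intro h
    choose x y hxy using fun i => exists_norm_of_normResidueSymbol_eq_brauerZero ha (h i)
    exact ⟨x, y, hxy⟩
  tfae_finish
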